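/- For a finite set $\mathcal{R}$ of regions in the plane, let $H(\mathcal{R})$ be the hypergraph with vertex set $\mathcal{R}$ whose hyperedges are the sets $r(p)=\{R\in\mathcal{R} : p\in R\}$, $p\in\mathbb{R}^2$. For an integer $k\ge 1$, a coloring of the vertices of a hypergraph $H$ is called $k$-Strong-Conflict-Free ($k$SCF) if (i) every hyperedge $e$ with $|e|\ge k$ contains at least $k$ vertices whose colors are unique among the colors assigned to the vertices of $e$, and (ii) in every hyperedge $e$ with $|e|<k$ all vertices get distinct colors. Let $f_H(k)$ denote the least integer $l$ such that $H$ admits a $k$SCF coloring with $l$ colors. **Theorem.** There is an absolute constant $C>0$ such that for all integers $k\ge 2$ and $n\ge 2$ and every set $\mathcal{R}$ of $n$ axis-parallel rectangles $[a,b]\times[c,d]$ (with $a<b$, $c<d$) in the plane, the hypergraph $H=H(\mathcal{R})$ satisfies $$f_H(k-1)\le C\,k\log^2 n ,$$ that is, $H$ admits a $(k-1)$SCF coloring with $O(k\log^2 n)$ colors, uniformly in $k$ and $n$. -/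

import Mathlib

namespace Hypergraph

/-- The vertices of `e` whose color is unique among the colors that `χ` assigns to the
vertices of `e`. -/
def uniquelyColored {V γ : Type*} (χ : V → γ) (e : Set V) : Set V :=
  {v | v ∈ e ∧ ∀ u ∈ e, χ u = χ v → u = v}

/-- `χ` is a `k`-Strong-Conflict-Free coloring of `H`: every hyperedge with at least `k` vertices
contains at least `k` vertices of unique color, and the vertices of every hyperedge
with fewer than `k` vertices get pairwise distinct colors. -/
def IsSCFColoring {V γ : Type*} (H : Hypergraph V) (k : ℕ) (χ : V → γ) : Prop :=
  (∀ e ∈ H.edgeSet, (k : ℕ∞) ≤ e.encard → (k : ℕ∞) ≤ (uniquelyColored χ e).encard) ∧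
  (∀ e ∈ H.edgeSet, e.encard < (k : ℕ∞) → Set.InjOn χ e)

/-- `H` admits a `k`-Strong-Conflict-Free coloring of its vertices with the `l` colors
`0, …, l - 1` (values of `χ` outside the vertex set of `H` are irrelevant). -/
def SCFColorable {V : Type*} (H : Hypergraph V) (k l : ℕ) : Prop :=
  ∃ χ : V → ℕ, (∀ v ∈ H.vertexSet, χ v < l) ∧ H.IsSCFColoring k χ

/-- `f_H(k)`: the least `l` such that `H` admits a `k`-Strong-Conflict-Free coloring with
`l` colors. -/
noncomputable def scfNumber {V : Type*} (H : Hypergraph V) (k : ℕ) : ℕ :=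
  sInf {l : ℕ | H.SCFColorable k l}

/-- The hypergraph `H(R)` induced by a finite set `R` of regions in `X`: its vertices are the
regions, and its hyperedges are the sets `r(p) = {S ∈ R : p ∈ S}` for the points `p` of `X`. -/
def induced {X : Type*} (R : Finset (Set X)) : Hypergraph (Set X) where
  vertexSet := {S | S ∈ R}
  edgeSet := Set.range fun p : X => {S : Set X | S ∈ R ∧ p ∈ S}
  subset_vertexSet_of_mem_edgeSet' := by
    rintro _ ⟨p, rfl⟩ S hS
    exact hS.1

end Hypergraph

/-- A (closed, nondegenerate) axis-parallel rectangle `[a, b] × [c, d]` in the plane. -/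
def IsAxisParallelRectangle (S : Set (ℝ × ℝ)) : Prop :=
  ∃ a b c d : ℝ, a < b ∧ c < d ∧ S = Set.Icc a b ×ˢ Set.Icc c d

/-! Call a coloring colorful if every hyperedge `e` sees at least `min k |e|` colors. Suppose every
subfamily has such a coloring with `c` colors. Give a largest color class `W` a fresh color, delete
it, and recurse: the family shrinks by a factor `1 - 1/c`, so slightly more than `c * log n` rounds
exhaust it. If the rest of a hyperedge is rainbow, then either the hyperedge meets `W` at most once
and stays rainbow, or it was not rainbow, so it saw `k` colors and keeps `k - 1` uniquely colored
members outside `W` (`exists_uniquelyColored_of_isColorful`).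

It remains to get `c = O(k log n)`. Median vertical lines split the family into `O(log n)` levels
(`exists_isColorful_rect`). For rectangles meeting one vertical line, only one side edge matters on
each side of it, and a sweep over heights bounds the pairs sharing a hyperedge of size at most `k`
by `O(k)` per rectangle (`card_biUnion_topRanked_product_le`). Some rectangle then has few such
neighbors, and greedy coloring uses `O(k)` colors. -/

open Finset

/-! ### Colorful colorings, and how they yield strong conflict-free ones -/

section Colorful

variable {ι P : Type*}

open scoped Classical in
/-- The members of `s` that are related to the point `p`. -/
noncomputable def hyperedgeAt (r : P → ι → Prop) (s : Finset ι) (p : P) : Finset ι :=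
  s.filter (r p)

lemma mem_hyperedgeAt {r : P → ι → Prop} {s : Finset ι} {p : P} {v : ι} :
    v ∈ hyperedgeAt r s p ↔ v ∈ s ∧ r p v := by
  simp [hyperedgeAt]

/-- Every hyperedge `e` sees at least `min k |e|` colors. -/
def IsColorful (r : P → ι → Prop) (s : Finset ι) (k : ℕ) (χ : ι → ℕ) : Prop :=
  ∀ p, min k (hyperedgeAt r s p).card ≤ ((hyperedgeAt r s p).image χ).card

open scoped Classical in
/-- The members of `s` that share with `v` a hyperedge of size at most `k`. -/
noncomputable def shallowNeighbors (r : P → ι → Prop) (s : Finset ι) (k : ℕ) (v : ι) :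
    Finset ι :=
  s.filter fun u => ∃ p, r p u ∧ r p v ∧ (hyperedgeAt r s p).card ≤ k

/-- Greedy coloring by degeneracy: color all but a low-degree `v`, then avoid the colors of its
shallow neighbors. A hyperedge through `v` of size at most `k` gains a new color; a larger one
already sees `k` colors without `v`. -/
lemma exists_isColorful_of_shallowNeighbors (r : P → ι → Prop) (k D : ℕ) (s : Finset ι)
    (h : ∀ t ⊆ s, t.Nonempty → ∃ v ∈ t, (shallowNeighbors r t k v).card < D) :
    ∃ χ : ι → ℕ, (∀ v ∈ s, χ v < D) ∧ IsColorful r s k χ := by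
  classical
  induction s using Finset.strongInduction with
  | H s ih =>
    rcases s.eq_empty_or_nonempty with rfl | hs
    · exact ⟨fun _ => 0, by simp, fun p => by simp [hyperedgeAt]⟩
    obtain ⟨v, hv, hdeg⟩ := h s subset_rfl hs
    obtain ⟨χ, hχ, hcol⟩ := ih (s.erase v) (erase_ssubset hv)
      fun t ht => h t (ht.trans (erase_subset _ _))
    have hex : ∃ x ∈ range D, x ∉ (shallowNeighbors r s k v).image χ := by
      by_contra! hcon
      have := card_le_card (show range D ⊆ _ from hcon)
      have := this.trans card_image_le
      simp at this
      omega
    obtain ⟨x, hxD, hx⟩ := hex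
    rw [mem_range] at hxD
    refine ⟨Function.update χ v x, ?_, ?_⟩
    · intro u hu
      by_cases huv : u = v
      · subst huv; simpa using hxD
      · simpa [huv] using hχ u (mem_erase.2 ⟨huv, hu⟩)
    · intro p
      have he : hyperedgeAt r (s.erase v) p = (hyperedgeAt r s p).erase v := by
        ext u; simp [mem_hyperedgeAt, and_assoc]
      have hc := hcol p
      have himg : ((hyperedgeAt r s p).erase v).image (Function.update χ v x)
          = ((hyperedgeAt r s p).erase v).image χ := by
        apply image_congr
        intro u hu
        have : u ≠ v := (mem_erase.1 hu).1
        simp [this]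
      rw [he] at hc
      by_cases hvp : v ∈ hyperedgeAt r s p
      · have hcard := card_erase_add_one hvp
        by_cases hk : (hyperedgeAt r s p).card ≤ k
        · have hnot : x ∉ ((hyperedgeAt r s p).erase v).image χ := by
            intro hmem
            apply hx
            refine image_subset_image ?_ hmem
            intro u hu
            have hu' := mem_hyperedgeAt.1 (mem_erase.1 hu).2
            simp only [shallowNeighbors, mem_filter]
            exact ⟨hu'.1, p, hu'.2, (mem_hyperedgeAt.1 hvp).2, hk⟩
          have : (hyperedgeAt r s p).image (Function.update χ v x)
              = insert x (((hyperedgeAt r s p).erase v).image χ) := by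
            conv_lhs => rw [← insert_erase hvp, image_insert, himg]
            simp
          rw [this, card_insert_of_notMem hnot]
          omega
        · have := card_le_card (image_subset_image (f := Function.update χ v x)
            (erase_subset v (hyperedgeAt r s p)))
          rw [himg] at this
          omega
      · rw [erase_eq_of_notMem hvp] at hc himg
        rw [himg]; exact hc

/-- Removing a largest color class of a colorful coloring, `l` times over, gives a coloring with
`l` colors in which every hyperedge is rainbow or has `k - 1` uniquely colored vertices. -/
lemma exists_uniquelyColored_of_isColorful (r : P → ι → Prop) (k c : ℕ) (s : Finset ι)
    (h : ∀ t ⊆ s, ∃ χ : ι → ℕ, (∀ v ∈ t, χ v < c) ∧ IsColorful r t k χ) (l : ℕ) :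
    s.card * (c - 1) ^ l < c ^ l →
    ∃ χ : ι → ℕ, (∀ v ∈ s, χ v < l) ∧ ∀ p,
      Set.InjOn χ (hyperedgeAt r s p) ∨ ∃ w ⊆ hyperedgeAt r s p, k - 1 ≤ w.card ∧
        ∀ v ∈ w, ∀ u ∈ hyperedgeAt r s p, χ u = χ v → u = v := by
  classical
  induction l generalizing s with
  | zero =>
    intro hs
    have : s = ∅ := by simpa using hs
    subst this
    exact ⟨fun _ => 0, by simp, fun p => Or.inl (by simp [hyperedgeAt])⟩
  | succ l ih =>
    intro hs
    obtain ⟨φ, hφ, hcol⟩ := h s subset_rfl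
    have hc0 : 0 < c := by
      rcases Nat.eq_zero_or_pos c with rfl | hc
      · simp at hs
      · exact hc
    obtain ⟨y, -, hy⟩ : ∃ y ∈ range c, s.card ≤ c * (s.filter fun v => φ v = y).card := by
      by_contra! hcon
      have h1 := card_eq_sum_card_fiberwise (f := φ) (s := s) (t := range c)
        (fun v hv => by simpa using hφ v hv)
      have h2 : ∑ y ∈ range c, c * (s.filter fun v => φ v = y).card < ∑ y ∈ range c, s.card :=
        sum_lt_sum_of_nonempty (by simpa using hc0.ne') hcon
      rw [← mul_sum, ← h1] at h2
      simp at h2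
    set W := s.filter fun v => φ v = y with hW
    have hWs : W ⊆ s := filter_subset _ _
    have hcard : (s \ W).card * c ≤ s.card * (c - 1) := by
      rw [card_sdiff_of_subset hWs, Nat.sub_mul, Nat.mul_sub, mul_one, mul_comm W.card]
      omega
    obtain ⟨χ, hχ, hQ⟩ := ih (s \ W) (fun t ht => h t (ht.trans sdiff_subset)) (by
      have h1 : (s \ W).card * c * (c - 1) ^ l < c ^ l * c := by
        calc _ ≤ s.card * (c - 1) * (c - 1) ^ l := Nat.mul_le_mul_right _ hcard
          _ = s.card * (c - 1) ^ (l + 1) := by ring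
          _ < _ := by rwa [← pow_succ]
      refine lt_of_mul_lt_mul_right (a := c) ?_ (Nat.zero_le _)
      calc _ = (s \ W).card * c * (c - 1) ^ l := by ring
        _ < _ := h1)
    refine ⟨fun v => if v ∈ W then l else χ v, ?_, ?_⟩
    · intro v hv
      by_cases hvW : v ∈ W
      · simp [hvW]
      · simpa [hvW] using (hχ v (mem_sdiff.2 ⟨hv, hvW⟩)).trans (Nat.lt_succ_self l)
    intro p
    set e := hyperedgeAt r s p with he
    have he' : hyperedgeAt r (s \ W) p = e \ W := by
      ext u; simp only [mem_hyperedgeAt, mem_sdiff, he]; tauto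
    have hes : e ⊆ s := filter_subset _ _
    have hsep : ∀ v ∈ e, ∀ u ∈ e, v ∉ W → (if u ∈ W then l else χ u)
        = (if v ∈ W then l else χ v) → u ∉ W ∧ χ u = χ v := by
      intro v hv u hu hvW huv
      have := hχ v (mem_sdiff.2 ⟨hes hv, hvW⟩)
      by_cases huW : u ∈ W
      · simp only [huW, hvW, if_true, if_false] at huv; omega
      · exact ⟨huW, by simpa [huW, hvW] using huv⟩
    have hlift : ∀ w ⊆ e \ W, (∀ v ∈ w, ∀ u ∈ e \ W, χ u = χ v → u = v) →
        ∀ v ∈ w, ∀ u ∈ e, (if u ∈ W then l else χ u) = (if v ∈ W then l else χ v) → u = v := by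
      intro w hw huniq v hv u hu huv
      obtain ⟨hve, hvW⟩ := mem_sdiff.1 (hw hv)
      obtain ⟨huW, h2⟩ := hsep v hve u hu hvW huv
      exact huniq v hv u (mem_sdiff.2 ⟨hu, huW⟩) h2
    rcases hQ p with hinj | ⟨w, hw, hwk, hwu⟩
    · rw [he'] at hinj
      by_cases hone : ∀ u ∈ e, ∀ v ∈ e, u ∈ W → v ∈ W → u = v
      · left
        intro u hu v hv huv
        by_cases hvW : v ∈ W
        · by_cases huW : u ∈ W
          · exact hone u hu v hv huW hvW
          · exact absurd hvW (hsep u hu v hv huW huv.symm).1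
        · obtain ⟨huW, h2⟩ := hsep v hv u hu hvW huv
          exact hinj (by simpa using ⟨hu, huW⟩) (by simpa using ⟨hv, hvW⟩) h2
      · right
        refine ⟨e \ W, sdiff_subset, ?_, hlift _ subset_rfl fun v hv u hu huv =>
          hinj (mem_coe.2 hu) (mem_coe.2 hv) huv⟩
        push Not at hone
        obtain ⟨u, hu, v, hv, huW, hvW, huv⟩ := hone
        -- Two members of `e` share the color `y`, so the minimum in `IsColorful` must be `k`;
        -- discarding `W` loses only the color `y`.
        have hlt : (e.image φ).card < e.card := by
          refine lt_of_le_of_ne card_image_le fun heq => huv ?_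
          exact card_image_iff.1 heq hu hv
            ((mem_filter.1 huW).2.trans (mem_filter.1 hvW).2.symm)
        have hck := hcol p
        rw [← he] at hck
        have himg : e.image φ ⊆ insert y ((e \ W).image φ) := by
          intro z hz
          obtain ⟨a, ha, rfl⟩ := mem_image.1 hz
          by_cases haW : a ∈ W
          · exact mem_insert.2 (Or.inl (mem_filter.1 haW).2)
          · exact mem_insert_of_mem (mem_image_of_mem _ (mem_sdiff.2 ⟨ha, haW⟩))
        have h1 := (card_le_card himg).trans (card_insert_le _ _)
        have h2 : ((e \ W).image φ).card ≤ (e \ W).card := card_image_le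
        omega
    · rw [he'] at hw hwu
      exact Or.inr ⟨w, hw.trans sdiff_subset, hwk, hlift w hw hwu⟩

end Colorful

/-! ### Sweep-line counting of simultaneously top ranked pairs -/

section TopRanked

variable {ι α : Type*} [LinearOrder α]

/-- The (at most `k`) highest ranked members of `s`. -/
def topRanked (ρ : ι → α) (k : ℕ) (s : Finset ι) : Finset ι :=
  s.filter fun v => (s.filter fun u => ρ v ≤ ρ u).card ≤ k

lemma mem_topRanked {ρ : ι → α} {k : ℕ} {s : Finset ι} {v : ι} :
    v ∈ topRanked ρ k s ↔ v ∈ s ∧ (s.filter fun u => ρ v ≤ ρ u).card ≤ k := by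
  simp [topRanked]

lemma card_topRanked_le (ρ : ι → α) (k : ℕ) (s : Finset ι) : (topRanked ρ k s).card ≤ k := by
  rcases (topRanked ρ k s).eq_empty_or_nonempty with h | h
  · simp [h]
  obtain ⟨v, hv, hmin⟩ := exists_min_image _ ρ h
  refine (card_le_card ?_).trans (mem_topRanked.1 hv).2
  intro u hu
  exact mem_filter.2 ⟨(mem_topRanked.1 hu).1, hmin u hu⟩

/-- A newcomer to the top `k` either has just arrived or was promoted by a departure from above. -/
lemma card_topRanked_sdiff_le [DecidableEq ι] {ρ : ι → α} (hρ : Function.Injective ρ) (k : ℕ)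
    (s t : Finset ι) : (topRanked ρ k t \ topRanked ρ k s).card ≤ (t \ s).card + (s \ t).card := by
  set A := (topRanked ρ k t \ topRanked ρ k s) ∩ s with hA
  have hsplit : topRanked ρ k t \ topRanked ρ k s ⊆ (t \ s) ∪ A := by
    intro v hv
    have hvt := (mem_topRanked.1 (mem_sdiff.1 hv).1).1
    by_cases hvs : v ∈ s
    · exact mem_union_right _ (mem_inter.2 ⟨hv, hvs⟩)
    · exact mem_union_left _ (mem_sdiff.2 ⟨hvt, hvs⟩)
  -- At least `k` members of `s` outrank the best promoted element `w`. Those that stay in `t`,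
  -- together with `A`, all rank at or above the worst promoted element `v`, which leaves room for
  -- only `k`.
  have hAcard : A.card ≤ (s \ t).card := by
    rcases A.eq_empty_or_nonempty with h | h
    · simp [h]
    obtain ⟨v, hv, hmin⟩ := exists_min_image _ ρ h
    obtain ⟨w, hw, hmax⟩ := exists_max_image _ ρ h
    have hvt := mem_topRanked.1 (mem_sdiff.1 (mem_inter.1 hv).1).1
    have hws : k < (s.filter fun u => ρ w ≤ ρ u).card := by
      by_contra hcon
      exact (mem_sdiff.1 (mem_inter.1 hw).1).2
        (mem_topRanked.2 ⟨(mem_inter.1 hw).2, not_lt.1 hcon⟩)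
    set U := (s.filter fun u => ρ w ≤ ρ u).erase w with hU
    have hUcard : U.card + 1 = (s.filter fun u => ρ w ≤ ρ u).card :=
      card_erase_add_one (mem_filter.2 ⟨(mem_inter.1 hw).2, le_rfl⟩)
    have hsub : A ∪ (U \ (s \ t)) ⊆ t.filter fun u => ρ v ≤ ρ u := by
      intro u hu
      rcases mem_union.1 hu with hu | hu
      · exact mem_filter.2 ⟨(mem_topRanked.1 (mem_sdiff.1 (mem_inter.1 hu).1).1).1, hmin u hu⟩
      · obtain ⟨hu1, hu2⟩ := mem_sdiff.1 hu
        obtain ⟨hus, hwu⟩ := mem_filter.1 (mem_of_mem_erase hu1)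
        refine mem_filter.2 ⟨?_, (hmin w hw).trans hwu⟩
        by_contra hut
        exact hu2 (mem_sdiff.2 ⟨hus, hut⟩)
    have hdisj : Disjoint A (U \ (s \ t)) := by
      rw [disjoint_left]
      intro u hu hu'
      have hu1 := (mem_sdiff.1 hu').1
      exact (mem_erase.1 hu1).1
        (hρ ((hmax u hu).antisymm (mem_filter.1 (mem_of_mem_erase hu1)).2))
    have h1 := card_le_card hsub
    rw [card_union_of_disjoint hdisj] at h1
    have h2 := le_card_sdiff (s \ t) U
    have h3 := hvt.2
    omega
  have := (card_le_card hsplit).trans (card_union_le _ _)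
  omega

/-- The members of `s` whose interval `[c v, d v]` contains `y`. -/
noncomputable def stab (c d : ι → ℝ) (s : Finset ι) (y : ℝ) : Finset ι :=
  s.filter fun v => c v ≤ y ∧ y ≤ d v

/-- Sweep-line bound for the pairs that are simultaneously top ranked at some point. -/
lemma card_biUnion_topRanked_product_le [DecidableEq ι] {ρ : ι → α} (hρ : Function.Injective ρ)
    (k : ℕ) (c d : ι → ℝ) (s : Finset ι) (Y : Finset ℝ) :
    (Y.biUnion fun y => topRanked ρ k (stab c d s y) ×ˢ topRanked ρ k (stab c d s y)).card
      ≤ 4 * k * s.card := by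
  set T : ℝ → Finset ι := fun y => topRanked ρ k (stab c d s y) with hT
  have hTk : ∀ y, (T y).card ≤ k := fun y => card_topRanked_le _ _ _
  -- The potential counts arrivals up to `z` and departures before `z`. Each event makes at most one
  -- member newly top ranked, hence at most `2 * k` new ordered pairs.
  have key : ∀ Y : Finset ℝ, ∀ z, (∀ y ∈ Y, y < z) →
      ((insert z Y).biUnion fun y => T y ×ˢ T y).card
        ≤ 2 * k * ((s.filter fun v => c v ≤ z).card + (s.filter fun v => d v < z).card) := by
    intro Y
    induction Y using Finset.induction_on_max with
    | empty =>
      intro z _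
      have h1 : (T z).card ≤ (s.filter fun v => c v ≤ z).card := by
        refine card_le_card fun v hv => ?_
        have := mem_filter.1 (mem_topRanked.1 hv).1
        exact mem_filter.2 ⟨this.1, this.2.1⟩
      simp only [insert_empty_eq, singleton_biUnion, card_product]
      have := Nat.mul_le_mul (hTk z) h1
      nlinarith [Nat.zero_le (k * (s.filter fun v => d v < z).card)]
    | insert a Y hmax ih =>
      intro z hz
      have haz : a < z := hz a (mem_insert_self _ _)
      have hIH := ih a hmax
      have hsub : ((insert z (insert a Y)).biUnion fun y => T y ×ˢ T y) ⊆
          ((insert a Y).biUnion fun y => T y ×ˢ T y) ∪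
            ((T z \ T a) ×ˢ T z ∪ T z ×ˢ (T z \ T a)) := by
        rw [biUnion_insert]
        apply union_subset _ subset_union_left
        rintro ⟨u, v⟩ huv
        obtain ⟨hu, hv⟩ := mem_product.1 huv
        simp only at hu hv
        simp only [mem_union, mem_product, mem_sdiff, mem_biUnion, mem_insert]
        by_cases hua : u ∈ T a
        · by_cases hva : v ∈ T a
          · exact Or.inl ⟨a, Or.inl rfl, hua, hva⟩
          · exact Or.inr (Or.inr ⟨hu, hv, hva⟩)
        · exact Or.inr (Or.inl ⟨⟨hu, hua⟩, hv⟩)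
      have hdiff := card_topRanked_sdiff_le hρ k (stab c d s a) (stab c d s z)
      change (T z \ T a).card ≤ _ at hdiff
      have hc : (s.filter fun v => c v ≤ a).card + (stab c d s z \ stab c d s a).card
          ≤ (s.filter fun v => c v ≤ z).card := by
        rw [← card_union_of_disjoint]
        · refine card_le_card fun v hv => ?_
          simp only [mem_union, mem_filter, mem_sdiff, stab] at hv ⊢
          rcases hv with hv | hv
          · exact ⟨hv.1, hv.2.trans haz.le⟩
          · exact ⟨hv.1.1, hv.1.2.1⟩
        · rw [disjoint_left]
          intro v hv hv'
          simp only [mem_filter, mem_sdiff, stab] at hv hv'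
          exact hv'.2 ⟨hv.1, hv.2, haz.le.trans hv'.1.2.2⟩
      have hd : (s.filter fun v => d v < a).card + (stab c d s a \ stab c d s z).card
          ≤ (s.filter fun v => d v < z).card := by
        rw [← card_union_of_disjoint]
        · refine card_le_card fun v hv => ?_
          simp only [mem_union, mem_filter, mem_sdiff, stab] at hv ⊢
          rcases hv with hv | hv
          · exact ⟨hv.1, hv.2.trans haz⟩
          · refine ⟨hv.1.1, ?_⟩
            by_contra hcon
            exact hv.2 ⟨hv.1.1, hv.1.2.1.trans haz.le, not_lt.1 hcon⟩
        · rw [disjoint_left]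
          intro v hv hv'
          simp only [mem_filter, mem_sdiff, stab] at hv hv'
          exact absurd hv.2 (not_lt.2 hv'.1.2.2)
      have h1 := card_le_card hsub
      have h2 := h1.trans ((card_union_le _ _).trans
        (Nat.add_le_add_left (card_union_le _ _) _))
      rw [card_product, card_product] at h2
      have h3 := Nat.mul_le_mul hdiff (hTk z)
      have h4 := Nat.mul_le_mul_left (2 * k) (Nat.add_le_add hc hd)
      nlinarith
  rcases Y.eq_empty_or_nonempty with rfl | hY
  · simp
  · have h1 := key (Y.erase (Y.max' hY)) (Y.max' hY) fun y hy =>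
      lt_max'_of_mem_erase_max' _ _ hy
    rw [insert_erase (max'_mem _ _)] at h1
    have h2 := Nat.mul_le_mul_left (2 * k) (Nat.add_le_add
      (card_filter_le s fun v => c v ≤ Y.max' hY) (card_filter_le s fun v => d v < Y.max' hY))
    refine (h1.trans h2).trans (le_of_eq (by ring))

/-- Pairs that lie in a common superlevel set of `f`, of size at most `k`, among the members
stabbed at some height. -/
lemma card_filter_superlevel_le (k : ℕ) (c d f : ι → ℝ) (s : Finset ι)
    (E : Finset (ι × ι)) (hE : ∀ q ∈ E, ∃ x y : ℝ,
      q.1 ∈ (stab c d s y).filter (fun w => x ≤ f w) ∧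
      q.2 ∈ (stab c d s y).filter (fun w => x ≤ f w) ∧
      ((stab c d s y).filter fun w => x ≤ f w).card ≤ k) :
    E.card ≤ 4 * k * s.card := by
  classical
  -- An arbitrary order on `ι` breaks ties of `f`, making the ranking injective.
  let _ : LinearOrder ι := IsWellOrder.linearOrder WellOrderingRel
  let ρ : ι → ℝ ×ₗ ι := fun v => toLex (f v, v)
  have hρ : Function.Injective ρ := by
    intro u v huv
    exact congrArg Prod.snd (toLex.injective huv)
  have htop : ∀ x y v, v ∈ (stab c d s y).filter (fun w => x ≤ f w) →
      ((stab c d s y).filter fun w => x ≤ f w).card ≤ k →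
      v ∈ topRanked ρ k (stab c d s y) := by
    intro x y v hv hk
    obtain ⟨hvs, hxv⟩ := mem_filter.1 hv
    refine mem_topRanked.2 ⟨hvs, (card_le_card fun u hu => ?_).trans hk⟩
    obtain ⟨hus, hvu⟩ := mem_filter.1 hu
    exact mem_filter.2 ⟨hus, hxv.trans (Prod.Lex.monotone_fst _ _ hvu)⟩
  choose! x y h1 h2 h3 using hE
  refine le_trans (card_le_card fun q hq => ?_)
    (card_biUnion_topRanked_product_le hρ k c d s (E.image y))
  exact mem_biUnion.2 ⟨y q, mem_image_of_mem _ hq, mem_product.2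
    ⟨htop _ _ _ (h1 q hq) (h3 q hq), htop _ _ _ (h2 q hq) (h3 q hq)⟩⟩

end TopRanked

/-! ### Colorful colorings of rectangles -/

section Rectangles

variable {ι : Type*} (a b c d : ι → ℝ)

/-- The point `p` lies in the rectangle `[a v, b v] × [c v, d v]`. -/
def InRect (p : ℝ × ℝ) (v : ι) : Prop :=
  (a v ≤ p.1 ∧ p.1 ≤ b v) ∧ c v ≤ p.2 ∧ p.2 ≤ d v

/-- To the right of the line, membership of a point depends only on its height and on `b`; to the
left, on its height and on `-a`. Each side gives at most `4 * k * s.card` ordered pairs, so the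
average degree is at most `8 * k`. -/
lemma exists_card_shallowNeighbors_lt_of_line (k : ℕ) (hk : 1 ≤ k) (x₀ : ℝ) (s : Finset ι)
    (hs : s.Nonempty) (hline : ∀ v ∈ s, a v ≤ x₀ ∧ x₀ ≤ b v) :
    ∃ v ∈ s, (shallowNeighbors (InRect a b c d) s k v).card < 9 * k := by
  classical
  set r := InRect a b c d with hr
  let E : Finset (ι × ι) := (s ×ˢ s).filter fun q => q.2 ∈ shallowNeighbors r s k q.1
  have hEcard : E.card ≤ 8 * k * s.card := by
    let ER := (s ×ˢ s).filter fun q => ∃ p : ℝ × ℝ, x₀ ≤ p.1 ∧ r p q.1 ∧ r p q.2 ∧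
      (hyperedgeAt r s p).card ≤ k
    let EL := (s ×ˢ s).filter fun q => ∃ p : ℝ × ℝ, p.1 ≤ x₀ ∧ r p q.1 ∧ r p q.2 ∧
      (hyperedgeAt r s p).card ≤ k
    have hsub : E ⊆ ER ∪ EL := by
      intro q hq
      obtain ⟨hqs, hq⟩ := mem_filter.1 hq
      obtain ⟨-, p, h1, h2, h3⟩ := mem_filter.1 hq
      rcases le_total x₀ p.1 with h | h
      · exact mem_union_left _ (mem_filter.2 ⟨hqs, p, h, h2, h1, h3⟩)
      · exact mem_union_right _ (mem_filter.2 ⟨hqs, p, h, h2, h1, h3⟩)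
    have hR : ER.card ≤ 4 * k * s.card := by
      apply card_filter_superlevel_le k c d b
      intro q hq
      obtain ⟨hqs, p, hp, h1, h2, h3⟩ := mem_filter.1 hq
      have he : (stab c d s p.2).filter (fun w => p.1 ≤ b w) = hyperedgeAt r s p := by
        ext w
        simp only [stab, mem_filter, mem_hyperedgeAt, hr, InRect]
        constructor
        · rintro ⟨⟨hw, h⟩, hb⟩
          exact ⟨hw, ⟨(hline w hw).1.trans hp, hb⟩, h⟩
        · rintro ⟨hw, ⟨-, hb⟩, h⟩
          exact ⟨⟨hw, h⟩, hb⟩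
      refine ⟨p.1, p.2, ?_, ?_, ?_⟩ <;> rw [he]
      · exact mem_hyperedgeAt.2 ⟨(mem_product.1 hqs).1, h1⟩
      · exact mem_hyperedgeAt.2 ⟨(mem_product.1 hqs).2, h2⟩
      · exact h3
    have hL : EL.card ≤ 4 * k * s.card := by
      apply card_filter_superlevel_le k c d (fun v => -a v)
      intro q hq
      obtain ⟨hqs, p, hp, h1, h2, h3⟩ := mem_filter.1 hq
      have he : (stab c d s p.2).filter (fun w => -p.1 ≤ -a w) = hyperedgeAt r s p := by
        ext w
        simp only [stab, mem_filter, mem_hyperedgeAt, hr, InRect, neg_le_neg_iff]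
        constructor
        · rintro ⟨⟨hw, h⟩, ha⟩
          exact ⟨hw, ⟨ha, hp.trans (hline w hw).2⟩, h⟩
        · rintro ⟨hw, ⟨ha, -⟩, h⟩
          exact ⟨⟨hw, h⟩, ha⟩
      refine ⟨-p.1, p.2, ?_, ?_, ?_⟩ <;> rw [he]
      · exact mem_hyperedgeAt.2 ⟨(mem_product.1 hqs).1, h1⟩
      · exact mem_hyperedgeAt.2 ⟨(mem_product.1 hqs).2, h2⟩
      · exact h3
    have := (card_le_card hsub).trans (card_union_le _ _)
    linarith
  by_contra! hcon
  have hfib : ∑ v ∈ s, (shallowNeighbors r s k v).card ≤ E.card := by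
    rw [card_eq_sum_card_fiberwise (f := Prod.fst) (s := E) (t := s)
      (fun q hq => (mem_product.1 (mem_filter.1 hq).1).1)]
    refine sum_le_sum fun v hv => ?_
    refine card_le_card_of_injOn (fun u => (v, u)) (fun u hu => ?_)
      (fun u _ w _ h => congrArg Prod.snd h)
    have hu' : u ∈ shallowNeighbors r s k v := hu
    exact mem_filter.2 ⟨mem_filter.2 ⟨mem_product.2 ⟨hv, (mem_filter.1 hu').1⟩, hu'⟩, rfl⟩
  have h1 := (sum_le_sum hcon).trans (hfib.trans hEcard)
  simp only [sum_const, smul_eq_mul] at h1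
  have := Nat.mul_pos hk hs.card_pos
  nlinarith

lemma exists_isColorful_of_line (k : ℕ) (hk : 1 ≤ k) (x₀ : ℝ) (s : Finset ι)
    (hline : ∀ v ∈ s, a v ≤ x₀ ∧ x₀ ≤ b v) :
    ∃ χ : ι → ℕ, (∀ v ∈ s, χ v < 9 * k) ∧ IsColorful (InRect a b c d) s k χ :=
  exists_isColorful_of_shallowNeighbors _ _ _ _ fun t ht hne =>
    exists_card_shallowNeighbors_lt_of_line a b c d k hk x₀ t hne fun v hv => hline v (ht hv)

lemma exists_median_line (m : ℕ) (hm : 0 < m) (s : Finset ι) (hs : s.card < 2 * m)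
    (hms : m ≤ s.card) (hab : ∀ v ∈ s, a v ≤ b v) :
    ∃ x₀ : ℝ, (s.filter fun v => b v < x₀).card < m ∧ (s.filter fun v => x₀ < a v).card < m := by
  classical
  have hne : s.Nonempty := card_pos.1 (hm.trans_le hms)
  obtain ⟨w, hw, hwmax⟩ := exists_max_image s b hne
  have hF : (s.filter fun v => m ≤ (s.filter fun u => b u ≤ b v).card).Nonempty :=
    ⟨w, mem_filter.2 ⟨hw, by rwa [filter_true_of_mem hwmax]⟩⟩
  obtain ⟨v, hv, hmin⟩ := exists_min_image _ b hF
  obtain ⟨hvs, hvm⟩ := mem_filter.1 hv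
  refine ⟨b v, ?_, ?_⟩
  -- `b v` is the `m`-th smallest right end: if `m` of them were smaller, the largest of those would
  -- contradict minimality.
  · rcases (s.filter fun u => b u < b v).eq_empty_or_nonempty with h | h
    · simpa [h] using hm
    obtain ⟨u, hu, humax⟩ := exists_max_image _ b h
    obtain ⟨hus, huv⟩ := mem_filter.1 hu
    by_contra! hcon
    refine absurd (hmin u (mem_filter.2 ⟨hus, hcon.trans (card_le_card fun z hz => ?_)⟩))
      (not_le.2 huv)
    exact mem_filter.2 ⟨(mem_filter.1 hz).1, humax z hz⟩
  · have hdisj : Disjoint (s.filter fun u => b u ≤ b v) (s.filter fun u => b v < a u) := by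
      rw [disjoint_left]
      intro u hu hu'
      obtain ⟨hus, h1⟩ := mem_filter.1 hu
      have := hab u hus
      have := (mem_filter.1 hu').2
      linarith
    have h1 := card_le_card (union_subset (filter_subset (fun u => b u ≤ b v) s)
      (filter_subset (fun u => b v < a u) s))
    rw [card_union_of_disjoint hdisj] at h1
    omega

lemma exists_isColorful_rect (k : ℕ) (hk : 1 ≤ k) (L : ℕ) (s : Finset ι)
    (hs : s.card < 2 ^ L) (hab : ∀ v ∈ s, a v ≤ b v) :
    ∃ χ : ι → ℕ, (∀ v ∈ s, χ v < 9 * k * L) ∧ IsColorful (InRect a b c d) s k χ := by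
  classical
  induction L generalizing s with
  | zero =>
    have : s = ∅ := by simpa using hs
    subst this
    exact ⟨fun _ => 0, by simp, fun p => by simp [hyperedgeAt]⟩
  | succ L ih =>
    rcases lt_or_ge s.card (2 ^ L) with hlt | hge
    · obtain ⟨χ, hχ, hcol⟩ := ih s hlt hab
      exact ⟨χ, fun v hv => (hχ v hv).trans_le (Nat.mul_le_mul_left _ (Nat.le_succ L)), hcol⟩
    obtain ⟨x₀, hl, hr⟩ := exists_median_line a b (2 ^ L) (by positivity) s
      (by rw [pow_succ] at hs; omega) hge hab
    set r := InRect a b c d with hrdef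
    set left := s.filter fun v => b v < x₀ with hleft
    set right := s.filter fun v => x₀ < a v with hright
    set mid := s.filter fun v => a v ≤ x₀ ∧ x₀ ≤ b v with hmid
    obtain ⟨χl, hχl, hcl⟩ := ih left hl fun v hv => hab v (mem_filter.1 hv).1
    obtain ⟨χr, hχr, hcr⟩ := ih right hr fun v hv => hab v (mem_filter.1 hv).1
    obtain ⟨χm, hχm, hcm⟩ := exists_isColorful_of_line a b c d k hk x₀ mid
      fun v hv => (mem_filter.1 hv).2
    -- No point lies in both a left and a right rectangle, so these share a palette; the middle gets
    -- `9 * k` fresh colors.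
    let χ : ι → ℕ := fun v =>
      if b v < x₀ then χl v else if x₀ < a v then χr v else 9 * k * L + χm v
    have hχmid : ∀ v ∈ mid, χ v = 9 * k * L + χm v := by
      intro v hv
      have := (mem_filter.1 hv).2
      simp [χ, not_lt.2 this.1, not_lt.2 this.2]
    have hχleft : ∀ v ∈ left, χ v = χl v := by
      intro v hv
      simp [χ, (mem_filter.1 hv).2]
    have hχright : ∀ v ∈ right, χ v = χr v := by
      intro v hv
      obtain ⟨hvs, h1⟩ := mem_filter.1 hv
      have h2 : ¬ b v < x₀ := not_lt.2 (h1.le.trans (hab v hvs))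
      simp [χ, h1, h2]
    refine ⟨χ, ?_, ?_⟩
    · intro v hv
      rw [Nat.mul_succ]
      by_cases h1 : b v < x₀
      · have hv' : v ∈ left := mem_filter.2 ⟨hv, h1⟩
        rw [hχleft v hv']
        have := hχl v hv'
        omega
      by_cases h2 : x₀ < a v
      · have hv' : v ∈ right := mem_filter.2 ⟨hv, h2⟩
        rw [hχright v hv']
        have := hχr v hv'
        omega
      · have hv' : v ∈ mid := mem_filter.2 ⟨hv, not_lt.1 h2, not_lt.1 h1⟩
        rw [hχmid v hv']
        have := hχm v hv'
        omega
    · intro p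
      obtain ⟨side, χs, hside, hχs, hcs, hbound, hcover⟩ : ∃ side : Finset ι, ∃ χs : ι → ℕ,
          side ⊆ s ∧ (∀ v ∈ side, χ v = χs v) ∧ IsColorful r side k χs ∧
          (∀ v ∈ side, χs v < 9 * k * L) ∧
          hyperedgeAt r s p ⊆ hyperedgeAt r side p ∪ hyperedgeAt r mid p := by
        rcases le_total p.1 x₀ with hp | hp
        · refine ⟨left, χl, filter_subset _ _, hχleft, hcl, hχl, fun v hv => ?_⟩
          obtain ⟨hvs, hv⟩ := mem_hyperedgeAt.1 hv
          rcases lt_or_ge (b v) x₀ with h | h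
          · exact mem_union_left _ (mem_hyperedgeAt.2 ⟨mem_filter.2 ⟨hvs, h⟩, hv⟩)
          · exact mem_union_right _
              (mem_hyperedgeAt.2 ⟨mem_filter.2 ⟨hvs, hv.1.1.trans hp, h⟩, hv⟩)
        · refine ⟨right, χr, filter_subset _ _, hχright, hcr, hχr, fun v hv => ?_⟩
          obtain ⟨hvs, hv⟩ := mem_hyperedgeAt.1 hv
          rcases lt_or_ge x₀ (a v) with h | h
          · exact mem_union_left _ (mem_hyperedgeAt.2 ⟨mem_filter.2 ⟨hvs, h⟩, hv⟩)
          · exact mem_union_right _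
              (mem_hyperedgeAt.2 ⟨mem_filter.2 ⟨hvs, h, hp.trans hv.1.2⟩, hv⟩)
      set es := hyperedgeAt r side p with hes
      set em := hyperedgeAt r mid p with hem
      have hsub : es.image χ ∪ em.image χ ⊆ (hyperedgeAt r s p).image χ := by
        rw [← image_union]
        refine image_subset_image (union_subset (fun v hv => ?_) fun v hv => ?_)
        · have := mem_hyperedgeAt.1 hv
          exact mem_hyperedgeAt.2 ⟨hside this.1, this.2⟩
        · have := mem_hyperedgeAt.1 hv
          exact mem_hyperedgeAt.2 ⟨filter_subset _ _ this.1, this.2⟩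
      have hims : es.image χ = es.image χs :=
        image_congr fun v hv => hχs v (mem_hyperedgeAt.1 hv).1
      have himm : (em.image χ).card = (em.image χm).card := by
        rw [image_congr (g := (fun z => 9 * k * L + z) ∘ χm)
          fun v hv => hχmid v (mem_hyperedgeAt.1 hv).1, ← image_image]
        exact card_image_of_injective _ (add_right_injective _)
      have hdisj : Disjoint (es.image χ) (em.image χ) := by
        rw [disjoint_left]
        intro z hz hz'
        obtain ⟨u, hu, rfl⟩ := mem_image.1 hz
        obtain ⟨v, hv, hvu⟩ := mem_image.1 hz'
        have hu' := (mem_hyperedgeAt.1 hu).1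
        have h1 := hbound u hu'
        rw [hχmid v (mem_hyperedgeAt.1 hv).1, hχs u hu'] at hvu
        omega
      have h1 := card_le_card hsub
      rw [card_union_of_disjoint hdisj, himm, hims] at h1
      have h2 := (card_le_card hcover).trans (card_union_le _ _)
      have h3 : min k es.card ≤ (es.image χs).card := hcs p
      have h4 : min k em.card ≤ (em.image χm).card := hcm p
      omega

end Rectangles

/-! ### Number of rounds, and the final bound -/

lemma mul_pred_pow_lt_pow (n c l : ℕ) (hn : 1 ≤ n) (hc : 1 ≤ c)
    (hl : (c : ℝ) * Real.log n < l) : n * (c - 1) ^ l < c ^ l := by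
  have hc' : (0 : ℝ) < c := by exact_mod_cast hc
  have hn' : (0 : ℝ) < n := by exact_mod_cast hn
  have h1 : (1 - 1 / (c : ℝ)) ≤ Real.exp (-(1 / c)) := by
    have := Real.add_one_le_exp (-(1 / (c : ℝ)))
    linarith
  have h0 : 0 ≤ 1 - 1 / (c : ℝ) := by
    rw [sub_nonneg, div_le_one hc']
    exact_mod_cast hc
  have h2 : (1 - 1 / (c : ℝ)) ^ l ≤ Real.exp (-(l / c)) := by
    calc _ ≤ Real.exp (-(1 / c)) ^ l := pow_le_pow_left₀ h0 h1 l
      _ = Real.exp (-(l / c)) := by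
        rw [← Real.exp_nat_mul]; congr 1; ring
  have h3 : (n : ℝ) * (1 - 1 / (c : ℝ)) ^ l < 1 := by
    calc _ ≤ (n : ℝ) * Real.exp (-(l / c)) := by gcongr
      _ = Real.exp (Real.log n - l / c) := by
        rw [sub_eq_add_neg, Real.exp_add, Real.exp_log hn']
      _ < 1 := by
        rw [Real.exp_lt_one_iff, sub_neg, lt_div_iff₀ hc']
        linarith
  have h4 : ((n * (c - 1) ^ l : ℕ) : ℝ) < ((c ^ l : ℕ) : ℝ) := by
    push_cast [Nat.cast_sub hc]
    have h5 : (c : ℝ) - 1 = (1 - 1 / c) * c := by field_simp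
    rw [h5, mul_pow, ← mul_assoc]
    have : (0 : ℝ) < (c : ℝ) ^ l := by positivity
    nlinarith
  exact_mod_cast h4

lemma scfColorable_of_rect (k n L l : ℕ) (hk : 2 ≤ k) (hn : 1 ≤ n) (hL : n < 2 ^ L)
    (hl : ((9 * k * L : ℕ) : ℝ) * Real.log n < l)
    (R : Finset (Set (ℝ × ℝ))) (hcard : R.card = n) (hR : ∀ S ∈ R, IsAxisParallelRectangle S) :
    (Hypergraph.induced R).SCFColorable (k - 1) l := by
  classical
  have hL0 : 1 ≤ L := by
    rcases Nat.eq_zero_or_pos L with rfl | h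
    · simp at hL; omega
    · exact h
  choose! a b c d hab hcd hS using hR
  have hmem : ∀ S ∈ R, ∀ p : ℝ × ℝ, p ∈ S ↔ InRect a b c d p S := by
    intro S hSR p
    conv_lhs => rw [hS S hSR]
    exact Iff.rfl
  obtain ⟨χ, hχ, hQ⟩ := exists_uniquelyColored_of_isColorful (InRect a b c d) k (9 * k * L) R
    (fun t ht => exists_isColorful_rect a b c d k (by omega) L t
      ((card_le_card ht).trans_lt (by omega)) fun v hv => (hab v (ht hv)).le) l
    (by
      rw [hcard]
      exact mul_pred_pow_lt_pow n _ l hn (Nat.mul_pos (by omega) hL0) hl)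
  have hedge : ∀ p : ℝ × ℝ, {S : Set (ℝ × ℝ) | S ∈ R ∧ p ∈ S}
      = (hyperedgeAt (InRect a b c d) R p : Set (Set (ℝ × ℝ))) := by
    intro p
    ext S
    simp only [Set.mem_ofPred_eq, mem_coe, mem_hyperedgeAt]
    exact and_congr_right fun h => hmem S h p
  refine ⟨χ, hχ, ?_, ?_⟩
  · rintro _ ⟨p, rfl⟩ he
    simp only [hedge p] at he ⊢
    rcases hQ p with hinj | ⟨w, hw, hwk, hwu⟩
    · refine he.trans (Set.encard_le_encard ?_)
      intro v hv
      exact ⟨hv, fun u hu huv => hinj hu hv huv⟩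
    · calc ((k - 1 : ℕ) : ℕ∞) ≤ (w.card : ℕ∞) := by exact_mod_cast hwk
        _ = (w : Set (Set (ℝ × ℝ))).encard := (Set.encard_coe_eq_coe_finsetCard w).symm
        _ ≤ _ := by
          refine Set.encard_le_encard ?_
          intro v hv
          exact ⟨hw hv, fun u hu huv => hwu v hv u hu huv⟩
  · rintro _ ⟨p, rfl⟩ he
    simp only [hedge p] at he ⊢
    rcases hQ p with hinj | ⟨w, hw, hwk, -⟩
    · exact hinj
    · rw [Set.encard_coe_eq_coe_finsetCard] at he
      have h1 : (hyperedgeAt (InRect a b c d) R p).card < k - 1 := by exact_mod_cast he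
      -- A hyperedge with fewer than `k - 1` members cannot contain `w`, so only the rainbow
      -- alternative survives.
      have h2 := card_le_card hw
      omega

theorem theorem5 :
    ∃ C : ℝ, 0 < C ∧ ∀ k n : ℕ, 2 ≤ k → 2 ≤ n →
      ∀ R : Finset (Set (ℝ × ℝ)), R.card = n → (∀ S ∈ R, IsAxisParallelRectangle S) →
        (Hypergraph.induced R).SCFColorable (k - 1)
            ((Hypergraph.induced R).scfNumber (k - 1)) ∧
          ((Hypergraph.induced R).scfNumber (k - 1) : ℝ) ≤
            C * (k : ℝ) * Real.log (n : ℝ) ^ 2 := by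
  refine ⟨30, by norm_num, fun k n hk hn R hcard hR => ?_⟩
  set L := Nat.log 2 n + 1 with hL
  set l := ⌊((9 * k * L : ℕ) : ℝ) * Real.log n⌋₊ + 1 with hl
  have hcol : (Hypergraph.induced R).SCFColorable (k - 1) l :=
    scfColorable_of_rect k n L l hk (by omega) (Nat.lt_pow_succ_log_self (by norm_num) n)
      (by rw [hl]; push_cast; exact_mod_cast Nat.lt_floor_add_one _) R hcard hR
  -- The infimum is attained, so the bound does not rest on the default `sInf ∅ = 0`.
  refine ⟨Nat.sInf_mem (s := {l | (Hypergraph.induced R).SCFColorable (k - 1) l}) ⟨l, hcol⟩, ?_⟩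
  have h1 : ((Hypergraph.induced R).scfNumber (k - 1) : ℝ) ≤ l := by
    exact_mod_cast Nat.sInf_le (s := {l | (Hypergraph.induced R).SCFColorable (k - 1) l}) hcol
  have hlog2 := Real.log_two_gt_d9
  have hlogn : Real.log 2 ≤ Real.log n :=
    Real.log_le_log (by norm_num) (by exact_mod_cast hn)
  have h2 : (Nat.log 2 n : ℝ) * Real.log 2 ≤ Real.log n := by
    rw [← Real.log_pow]
    apply Real.log_le_log (by positivity)
    exact_mod_cast Nat.pow_log_le_self 2 (by omega)
  have h3 : (L : ℝ) ≤ 3 * Real.log n := by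
    rw [hL]; push_cast
    nlinarith [Nat.cast_nonneg (α := ℝ) (Nat.log 2 n)]
  have hk' : (2 : ℝ) ≤ k := by exact_mod_cast hk
  have hpos : 0 < Real.log n := by linarith
  have h4 : (l : ℝ) ≤ 9 * k * L * Real.log n + 1 := by
    rw [hl]; push_cast
    have := Nat.floor_le (a := ((9 * k * L : ℕ) : ℝ) * Real.log n) (by positivity)
    push_cast at this
    linarith
  have h5 : 9 * k * L * Real.log n ≤ 9 * k * (3 * Real.log n) * Real.log n := by gcongr
  -- Absorbs the rounding `+ 1` in `l`: the constant is `30 = 9 * 3 + 3`.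
  have h6 : (1 : ℝ) ≤ 3 * k * Real.log n ^ 2 := by
    have : (0.48 : ℝ) ≤ Real.log n ^ 2 := by nlinarith
    nlinarith
  nlinarith
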